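/- Let $\Gamma$ be a countable group of homeomorphisms of the circle $\mathrm{S}^1$ (a countable subgroup of the group of all homeomorphisms of $\mathrm{S}^1$), and let $\mu$ be a probability measure on $\Gamma$ (with its discrete $\sigma$-algebra) which is non-degenerate, i.e. whose support $\{g \in \Gamma : \mu(g) > 0\}$ generates $\Gamma$ as a semigroup. A Borel probability measure $\nu$ on $\mathrm{S}^1$ is called $\mu$-stationary if $\mu * \nu = \nu$, where $\mu * \nu = \sum_{g \in \Gamma} \mu(g)\, g_*\nu$; equivalently, if $$\int_{\mathrm{S}^1} \psi \, d\nu = \int_{\Gamma} \int_{\mathrm{S}^1} \psi(g(x)) \, d\nu(x)\, d\mu(g)$$ for every continuous function $\psi : \mathrm{S}^1 \to \mathbb{R}$. If there is no Borel probability measure $\nu$ on $\mathrm{S}^1$ such that $g_*\nu = \nu$ for all $g \in \Gamma$, then there exists exactly one $\mu$-stationary Borel probability measure on $\mathrm{S}^1$. -/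

import Mathlib

open MeasureTheory

/-- A group `Γ` of homeomorphisms of the circle `ℝ / ℤ` preserves the Borel probability measure
`ν`. -/
def PreservesMeasure (Γ : Subgroup (UnitAddCircle ≃ₜ UnitAddCircle))
    (ν : ProbabilityMeasure UnitAddCircle) : Prop :=
  ∀ g ∈ Γ, Measure.map g (ν : Measure UnitAddCircle) = ν

/-- A probability `μ` on the discrete group `Γ` is non-degenerate: its support generates `Γ` as a
semigroup. -/
def IsNondegenerate {Γ : Subgroup (UnitAddCircle ≃ₜ UnitAddCircle)} (μ : PMF Γ) : Prop :=
  Subsemigroup.closure μ.support = ⊤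

/-- The convolution `μ * ν = ∑ g, μ(g) g(ν)`, where `g(ν)` is the image of `ν` under `g`. -/
noncomputable def actionConvolution {Γ : Subgroup (UnitAddCircle ≃ₜ UnitAddCircle)} (μ : PMF Γ)
    (ν : Measure UnitAddCircle) : Measure UnitAddCircle :=
  Measure.sum fun g : Γ => μ g • Measure.map (g : UnitAddCircle ≃ₜ UnitAddCircle) ν

/-- The probability measure `ν` on the circle is stationary with respect to `μ`: `μ * ν = ν`. -/
def IsStationaryMeasure {Γ : Subgroup (UnitAddCircle ≃ₜ UnitAddCircle)} (μ : PMF Γ)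
    (ν : ProbabilityMeasure UnitAddCircle) : Prop :=
  actionConvolution μ (ν : Measure UnitAddCircle) = ν

open Set Filter Topology
open scoped ENNReal BoundedContinuousFunction

/-! ### Averages, finite orbits and atoms of stationary measures. -/

section Stationary

variable {Γ : Subgroup (UnitAddCircle ≃ₜ UnitAddCircle)}

/-! Existence is the Krylov–Bogolyubov argument: any limit of Cesàro means of the random walk is
stationary.

For uniqueness, a finite invariant set would carry an invariant uniform measure, so there is none.
In particular stationary measures have no atoms, since the atoms of largest mass would form such a
set (`IsStationaryMeasure.nullSingletonClass`). The difference of two stationary measures therefore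
has a continuous primitive `H` on the circle (`exists_primitive_sub`), and the arcs on which the
difference is largest are those running from a minimum to a maximum of `H`. By stationarity the
difference on an arc is the average of its values on the preimages of the arc, so the preimages of a
maximal arc are maximal (`maximal_arc_preimage`).

If `H` is not constant, the closed disjoint sets of its minima and maxima are thus preserved or
exchanged by each element of `Γ`. By compactness only finitely many complementary arcs of one set
meet the other; their endpoints form a finite invariant set, a contradiction
(`exists_preservesMeasure_of_disjoint`). -/

theorem IsNondegenerate.induction {μ : PMF Γ} (hμ : IsNondegenerate μ) {p : Γ → Prop}
    (hsupp : ∀ g ∈ μ.support, p g) (hmul : ∀ g h, p g → p h → p (g * h)) (g : Γ) : p g := by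
  have hg : g ∈ Subsemigroup.closure μ.support := by
    rw [show Subsemigroup.closure μ.support = ⊤ from hμ]
    exact Subsemigroup.mem_top g
  induction hg using Subsemigroup.closure_induction with
  | mem x hx => exact hsupp x hx
  | mul x y _ _ hx hy => exact hmul x y hx hy

theorem actionConvolution_apply (μ : PMF Γ) (ν : Measure UnitAddCircle) {s : Set UnitAddCircle}
    (hs : MeasurableSet s) :
    actionConvolution μ ν s
      = ∑' g : Γ, μ g * ν ((g : UnitAddCircle ≃ₜ UnitAddCircle) ⁻¹' s) := by
  rw [actionConvolution, Measure.sum_apply _ hs]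
  refine tsum_congr fun g => ?_
  rw [Measure.smul_apply, Measure.map_apply (Homeomorph.continuous _).measurable hs, smul_eq_mul]

theorem PMF.summable_toReal {α : Type*} (μ : PMF α) : Summable fun a => (μ a).toReal :=
  ENNReal.summable_toReal μ.tsum_coe_ne_top

theorem PMF.tsum_toReal {α : Type*} (μ : PMF α) : ∑' a, (μ a).toReal = 1 := by
  rw [← ENNReal.tsum_toReal_eq μ.apply_ne_top, μ.tsum_coe, ENNReal.toReal_one]

theorem PMF.summable_toReal_mul {α : Type*} (μ : PMF α) {f : α → ℝ} {C : ℝ}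
    (hf : ∀ a, |f a| ≤ C) : Summable fun a => (μ a).toReal * f a := by
  refine Summable.of_norm_bounded (μ.summable_toReal.mul_right C) fun a => ?_
  rw [norm_mul, Real.norm_of_nonneg ENNReal.toReal_nonneg]
  exact mul_le_mul_of_nonneg_left (hf a) ENNReal.toReal_nonneg

/-- The maximum principle for averages. -/
theorem PMF.eq_of_tsum_toReal_mul_eq {α : Type*} (μ : PMF α) {f : α → ℝ} {C M : ℝ}
    (hf : ∀ a, |f a| ≤ C) (hM : ∀ a, f a ≤ M) (h : ∑' a, (μ a).toReal * f a = M)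
    {a : α} (ha : a ∈ μ.support) : f a = M := by
  have hs : HasSum (fun a => (μ a).toReal * (M - f a)) 0 := by
    have h1 := (μ.summable_toReal.mul_right M).hasSum.sub (μ.summable_toReal_mul hf).hasSum
    rw [h, tsum_mul_right, μ.tsum_toReal, one_mul, sub_self] at h1
    simpa only [mul_sub] using h1
  have h0 := (hasSum_zero_iff_of_nonneg fun a =>
    mul_nonneg ENNReal.toReal_nonneg (sub_nonneg.2 (hM a))).1 hs
  have h1 : (μ a).toReal * (M - f a) = 0 := congrFun h0 a
  have h2 : (μ a).toReal ≠ 0 := ENNReal.toReal_ne_zero.2 ⟨ha, μ.apply_ne_top a⟩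
  linarith [(mul_eq_zero.1 h1).resolve_left h2]

theorem IsStationaryMeasure.real_eq {μ : PMF Γ} {ν : ProbabilityMeasure UnitAddCircle}
    (hν : IsStationaryMeasure μ ν) {s : Set UnitAddCircle} (hs : MeasurableSet s) :
    (ν : Measure UnitAddCircle).real s = ∑' g : Γ, (μ g).toReal *
      (ν : Measure UnitAddCircle).real ((g : UnitAddCircle ≃ₜ UnitAddCircle) ⁻¹' s) := by
  have h := actionConvolution_apply μ (ν : Measure UnitAddCircle) hs
  rw [show actionConvolution μ (ν : Measure UnitAddCircle) = ν from hν] at h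
  rw [Measure.real, h, ENNReal.tsum_toReal_eq
    fun g => ENNReal.mul_ne_top (μ.apply_ne_top g) (measure_ne_top _ _)]
  simp only [ENNReal.toReal_mul, Measure.real]

theorem exists_preservesMeasure_of_finite {E : Set UnitAddCircle} (hE : E.Finite)
    (hne : E.Nonempty) (hmaps : ∀ g ∈ Γ, ∀ x ∈ E, g x ∈ E) :
    ∃ ν : ProbabilityMeasure UnitAddCircle, PreservesMeasure Γ ν := by
  classical
  lift E to Finset UnitAddCircle using hE
  have hcard : (E.card : ℝ≥0∞) ≠ 0 := by
    simpa [← Finset.nonempty_iff_ne_empty] using hne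
  refine ⟨⟨(E.card : ℝ≥0∞)⁻¹ • ∑ x ∈ E, Measure.dirac x, ⟨?_⟩⟩, fun g hg => ?_⟩
  · simp [Measure.finsetSum_apply, ENNReal.inv_mul_cancel hcard]
  · have himg : E.image g = E := by
      refine Finset.eq_of_subset_of_card_le (fun y hy => ?_) ?_
      · obtain ⟨x, hx, rfl⟩ := Finset.mem_image.1 hy
        exact hmaps g hg x hx
      · rw [Finset.card_image_of_injective _ g.injective]
    change Measure.map g ((E.card : ℝ≥0∞)⁻¹ • ∑ x ∈ E, Measure.dirac x)
      = (E.card : ℝ≥0∞)⁻¹ • ∑ x ∈ E, Measure.dirac x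
    rw [Measure.map_smul]
    congr 1
    have hg' : Measurable g := g.continuous.measurable
    have : Measure.map g (∑ x ∈ E, Measure.dirac x) = ∑ x ∈ E, Measure.dirac (g x) := by
      ext s hs
      rw [Measure.map_apply hg' hs, Measure.finsetSum_apply, Measure.finsetSum_apply]
      refine Finset.sum_congr rfl fun x _ => ?_
      rw [Measure.dirac_apply' _ hs, Measure.dirac_apply' _ (hg' hs)]
      rfl
    rw [this]
    conv_rhs => rw [← himg]
    rw [Finset.sum_image g.injective.injOn]

theorem IsStationaryMeasure.nullSingletonClass {μ : PMF Γ} (hμ : IsNondegenerate μ)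
    (hΓ : ¬ ∃ ν : ProbabilityMeasure UnitAddCircle, PreservesMeasure Γ ν)
    {ν : ProbabilityMeasure UnitAddCircle} (hν : IsStationaryMeasure μ ν) :
    NullSingletonClass (ν : Measure UnitAddCircle) := by
  set m : UnitAddCircle → ℝ := fun x => (ν : Measure UnitAddCircle).real {x} with hm
  refine ⟨fun x₀ => ?_⟩
  by_contra hx₀
  have hpos : 0 < m x₀ := ENNReal.toReal_pos hx₀ (measure_ne_top _ _)
  have hfin : ∀ c > 0, {x | c ≤ m x}.Finite := by
    intro c hc
    refine (Measure.finite_const_le_meas_of_disjoint_iUnion (ν : Measure UnitAddCircle)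
      (ε := ENNReal.ofReal c) (by simpa using hc) (fun x => measurableSet_singleton x)
      (fun x y hxy => by simpa using hxy) (measure_ne_top _ _)).subset fun x hx => ?_
    exact ENNReal.ofReal_le_of_le_toReal hx
  -- Only finitely many points are at least as heavy as `x₀`, so a heaviest atom exists.
  obtain ⟨x₁, hx₁, hmax⟩ := exists_max_image _ m (hfin _ hpos) ⟨x₀, le_refl (m x₀)⟩
  have hle : ∀ x, m x ≤ m x₁ := fun x =>
    (le_total (m x₀) (m x)).elim (fun h => hmax x h) fun h => h.trans hx₁
  have hinv : ∀ g : Γ, ∀ x, m x = m x₁ → m ((g : UnitAddCircle ≃ₜ UnitAddCircle).symm x) = m x₁ := by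
    refine hμ.induction (fun g hg x hx => ?_) fun g h hg hh x hx => hh _ (hg x hx)
    have hpre : ∀ g : Γ, (g : UnitAddCircle ≃ₜ UnitAddCircle) ⁻¹' {x}
        = {(g : UnitAddCircle ≃ₜ UnitAddCircle).symm x} := fun g => by
      ext y
      simp [Homeomorph.eq_symm_apply]
    have hsum := hν.real_eq (measurableSet_singleton x)
    simp only [hpre] at hsum
    refine μ.eq_of_tsum_toReal_mul_eq (C := 1)
      (f := fun g => m ((g : UnitAddCircle ≃ₜ UnitAddCircle).symm x))
      (fun g => ?_) (fun g => hle _) (hsum.symm.trans hx) hg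
    rw [abs_of_nonneg measureReal_nonneg]
    exact measureReal_le_one
  refine hΓ (exists_preservesMeasure_of_finite (E := {x | m x = m x₁})
    ((hfin _ (hpos.trans_le hx₁)).subset fun x hx => ge_of_eq hx) ⟨x₁, rfl⟩ fun g hg x hx => ?_)
  exact hinv ⟨g⁻¹, Γ.inv_mem hg⟩ x hx

end Stationary

/-! ### Open arcs of the circle. -/

section Arcs

/-- The open arc of the circle below the interval `(a, b)`. -/
def openArc (a b : ℝ) : Set UnitAddCircle := (fun t : ℝ => (t : UnitAddCircle)) '' Ioo a b

theorem isOpen_openArc (a b : ℝ) : IsOpen (openArc a b) :=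
  QuotientAddGroup.isOpenMap_coe _ isOpen_Ioo

theorem UnitAddCircle.continuous_coe : Continuous fun t : ℝ => (t : UnitAddCircle) :=
  AddCircle.continuous_mk' 1

theorem isPreconnected_openArc (a b : ℝ) : IsPreconnected (openArc a b) :=
  isPreconnected_Ioo.image _ UnitAddCircle.continuous_coe.continuousOn

theorem left_notMem_openArc {a b : ℝ} (hb : b ≤ a + 1) : (a : UnitAddCircle) ∉ openArc a b := by
  rintro ⟨t, ht, hta⟩
  have := (AddCircle.coe_eq_coe_iff_of_mem_Ico (p := (1 : ℝ)) (a := a)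
    ⟨ht.1.le, ht.2.trans_le hb⟩ ⟨le_rfl, by linarith⟩).1 hta
  exact ht.1.ne' this

theorem right_notMem_openArc {a b : ℝ} (hb : b ≤ a + 1) : (b : UnitAddCircle) ∉ openArc a b := by
  rintro ⟨t, ht, hta⟩
  have := (AddCircle.coe_eq_coe_iff_of_mem_Ioc (p := (1 : ℝ)) (a := b - 1)
    ⟨by linarith [ht.1], by linarith [ht.2]⟩ ⟨by linarith, by linarith⟩).1 hta
  exact ht.2.ne this

/-- Equality `b = a + 1` is allowed: the arc is then a punctured circle and its two endpoints
coincide. -/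
theorem frontier_openArc {a b : ℝ} (hab : a < b) (hb : b ≤ a + 1) :
    frontier (openArc a b) = {(a : UnitAddCircle), (b : UnitAddCircle)} := by
  have hcl : closure (openArc a b) = (fun t : ℝ => (t : UnitAddCircle)) '' Icc a b := by
    refine Subset.antisymm (closure_minimal (image_mono Ioo_subset_Icc_self)
      (isCompact_Icc.image UnitAddCircle.continuous_coe).isClosed) ?_
    rw [← closure_Ioo hab.ne]
    exact image_closure_subset_closure_image UnitAddCircle.continuous_coe
  rw [frontier, hcl, (isOpen_openArc a b).interior_eq]
  ext x
  constructor
  · rintro ⟨⟨t, ht, rfl⟩, hx⟩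
    rcases ht.1.eq_or_lt with rfl | h1
    · exact Or.inl rfl
    rcases ht.2.eq_or_lt with rfl | h2
    · exact Or.inr rfl
    exact absurd ⟨t, ⟨h1, h2⟩, rfl⟩ hx
  · rintro (rfl | rfl)
    · exact ⟨⟨a, left_mem_Icc.2 hab.le, rfl⟩, left_notMem_openArc hb⟩
    · exact ⟨⟨b, right_mem_Icc.2 hab.le, rfl⟩, right_notMem_openArc hb⟩

/-- Removing a point outside `U` leaves a chart onto an interval of length one, where `U` becomes an
open interval. -/
theorem exists_eq_openArc {U : Set UnitAddCircle} (hU : IsOpen U) (hc : IsPreconnected U)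
    (hne : U.Nonempty) (huniv : U ≠ univ) :
    ∃ a b : ℝ, a < b ∧ b ≤ a + 1 ∧ U = openArc a b := by
  obtain ⟨p, hp⟩ := (ne_univ_iff_exists_notMem U).1 huniv
  obtain ⟨p, rfl⟩ := QuotientAddGroup.mk_surjective p
  set e := AddCircle.openPartialHomeomorphCoe (1 : ℝ) p with he
  have hUt : U ⊆ e.target := fun x hx => by
    simp only [he, AddCircle.openPartialHomeomorphCoe_target]
    rintro rfl
    exact hp hx
  have hVs : e.symm '' U ⊆ Ioo p (p + 1) := by
    rintro _ ⟨x, hx, rfl⟩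
    exact e.map_target (hUt hx)
  have hVU : (fun t : ℝ => (t : UnitAddCircle)) '' (e.symm '' U) = U :=
    e.image_symm_image_of_subset_target hUt
  set V := e.symm '' U with hV
  have hVo : IsOpen V := e.symm.isOpen_image_of_subset_source hU hUt
  have hVc : IsConnected V := ⟨hne.image _, hc.image _ (e.symm.continuousOn.mono hUt)⟩
  have hbb : BddBelow V := ⟨p, fun x hx => (hVs hx).1.le⟩
  have hba : BddAbove V := ⟨p + 1, fun x hx => (hVs hx).2.le⟩
  have hVeq : V = Ioo (sInf V) (sSup V) := by
    refine Subset.antisymm ?_ (hVc.Ioo_csInf_csSup_subset hbb hba)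
    have := interior_mono (subset_Icc_csInf_csSup hbb hba)
    rwa [hVo.interior_eq, interior_Icc] at this
  obtain ⟨t, ht⟩ := hVc.nonempty
  have ht' := hVeq ▸ ht
  refine ⟨sInf V, sSup V, ht'.1.trans ht'.2, ?_, ?_⟩
  · have h1 : p ≤ sInf V := le_csInf hVc.nonempty fun x hx => (hVs hx).1.le
    have h2 : sSup V ≤ p + 1 := csSup_le hVc.nonempty fun x hx => (hVs hx).2.le
    linarith
  · rw [openArc, ← hVeq, hVU]

end Arcs

/-! ### Distribution functions and primitives on the circle. -/

section Primitive

/-- The representative in `(0, 1]` of a point of the circle. -/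
noncomputable def circleRep (x : UnitAddCircle) : ℝ := AddCircle.equivIoc 1 0 x

theorem measurable_circleRep : Measurable circleRep :=
  measurable_subtype_coe.comp (AddCircle.measurableEquivIoc 1 0).measurable

theorem coe_circleRep (x : UnitAddCircle) : (circleRep x : UnitAddCircle) = x :=
  AddCircle.coe_equivIoc (p := (1 : ℝ)) (a := 0)

theorem circleRep_mem (x : UnitAddCircle) : circleRep x ∈ Ioc (0 : ℝ) 1 := by
  have h := (AddCircle.equivIoc (1 : ℝ) 0 x).2
  exact ⟨h.1, h.2.trans_eq (zero_add 1)⟩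

theorem circleRep_coe {t : ℝ} (ht : t ∈ Ioc (0 : ℝ) 1) : circleRep t = t :=
  AddCircle.equivIoc_coe_of_mem (p := (1 : ℝ)) (a := 0) (by rwa [zero_add])

theorem circleRep_preimage_of_le {a b : ℝ} (ha : 0 ≤ a) (hb : b ≤ 1) :
    circleRep ⁻¹' Ioo a b = openArc a b := by
  ext x
  constructor
  · exact fun hx => ⟨circleRep x, hx, coe_circleRep x⟩
  · rintro ⟨t, ht, rfl⟩
    change circleRep t ∈ Ioo a b
    rwa [circleRep_coe ⟨ha.trans_lt ht.1, ht.2.le.trans hb⟩]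

theorem circleRep_preimage_of_lt {a b : ℝ} (ha : 0 ≤ a) (ha1 : a < 1) (hb : 1 < b)
    (hba : b ≤ a + 1) :
    circleRep ⁻¹' (Ioc a 1 ∪ Ioo 0 (b - 1)) = openArc a b := by
  ext x
  constructor
  · rintro (hx | hx)
    · exact ⟨circleRep x, ⟨hx.1, hx.2.trans_lt hb⟩, coe_circleRep x⟩
    · refine ⟨circleRep x + 1, ⟨by linarith [hx.1], by linarith [hx.2]⟩, ?_⟩
      change ((circleRep x + 1 : ℝ) : UnitAddCircle) = x
      rw [AddCircle.coe_add_period, coe_circleRep]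
  · rintro ⟨t, ht, rfl⟩
    change circleRep t ∈ Ioc a 1 ∪ Ioo 0 (b - 1)
    rcases le_or_gt t 1 with h | h
    · rw [circleRep_coe ⟨ha.trans_lt ht.1, h⟩]
      exact Or.inl ⟨ht.1, h⟩
    · have : (t : UnitAddCircle) = ((t - 1 : ℝ) : UnitAddCircle) := by
        rw [← AddCircle.coe_add_period 1 (t - 1), sub_add_cancel]
      rw [this, circleRep_coe ⟨by linarith, by linarith [ht.2]⟩]
      exact Or.inr ⟨by linarith, by linarith [ht.2]⟩

theorem openArc_add_intCast (a b : ℝ) (n : ℤ) : openArc (a + n) (b + n) = openArc a b := by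
  have h : ∀ t : ℝ, ((t + n : ℝ) : UnitAddCircle) = t := fun t => by
    rw [AddCircle.coe_add, show ((n : ℝ) : UnitAddCircle) = 0 from
      (AddCircle.coe_eq_zero_iff 1).2 ⟨n, by simp⟩, add_zero]
  rw [openArc, openArc, ← image_add_const_Ioo, image_image]
  simp only [h]

/-- The distribution function of a measure on the circle, cut at `0`. -/
noncomputable def circleCDF (ν : Measure UnitAddCircle) (t : ℝ) : ℝ :=
  (ν.map circleRep).real (Iic t)

variable (ν : Measure UnitAddCircle)

theorem circleCDF_zero : circleCDF ν 0 = 0 := by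
  have : circleRep ⁻¹' Iic 0 = ∅ := by
    ext x
    simpa using (circleRep_mem x).1
  rw [circleCDF, map_measureReal_apply measurable_circleRep measurableSet_Iic, this,
    measureReal_empty]

instance [NullSingletonClass ν] : NullSingletonClass (ν.map circleRep) := by
  refine ⟨fun t => ?_⟩
  rw [Measure.map_apply measurable_circleRep (measurableSet_singleton t)]
  refine measure_mono_null (t := {(t : UnitAddCircle)}) (fun x hx => ?_) (measure_singleton _)
  rw [mem_singleton_iff, ← coe_circleRep x, show circleRep x = t from hx]

variable [IsProbabilityMeasure ν]

instance : IsProbabilityMeasure (ν.map circleRep) :=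
  Measure.isProbabilityMeasure_map measurable_circleRep.aemeasurable

theorem circleCDF_one : circleCDF ν 1 = 1 := by
  have : circleRep ⁻¹' Iic 1 = univ := by
    ext x
    simpa using (circleRep_mem x).2
  rw [circleCDF, map_measureReal_apply measurable_circleRep measurableSet_Iic, this,
    probReal_univ]

theorem real_Ioc_map_circleRep {a b : ℝ} (hab : a ≤ b) :
    (ν.map circleRep).real (Ioc a b) = circleCDF ν b - circleCDF ν a := by
  rw [← Iic_sdiff_Iic, measureReal_sdiff (Iic_subset_Iic.2 hab) measurableSet_Iic]
  rfl

theorem continuous_circleCDF [NullSingletonClass ν] : Continuous (circleCDF ν) := by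
  have h := intervalIntegral.continuous_primitive (μ := ν.map circleRep) (f := fun _ => (1 : ℝ))
    (fun a b => intervalIntegrable_const) 0
  have h2 : circleCDF ν = fun b => (∫ _ in (0 : ℝ)..b, (1 : ℝ) ∂(ν.map circleRep)) := by
    ext b
    rw [intervalIntegral.integral_const']
    rcases le_total 0 b with hb | hb
    · rw [Ioc_eq_empty (not_lt.2 hb), real_Ioc_map_circleRep _ hb, circleCDF_zero]
      simp
    · rw [Ioc_eq_empty (not_lt.2 hb), real_Ioc_map_circleRep _ hb, circleCDF_zero]
      simp
  rw [h2]
  exact h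

theorem real_openArc_of_le [NullSingletonClass ν] {a b : ℝ} (ha : 0 ≤ a) (hab : a ≤ b)
    (hb : b ≤ 1) : ν.real (openArc a b) = circleCDF ν b - circleCDF ν a := by
  rw [← circleRep_preimage_of_le ha hb, ← map_measureReal_apply measurable_circleRep
    measurableSet_Ioo, measureReal_congr Ioo_ae_eq_Ioc, real_Ioc_map_circleRep _ hab]

theorem real_openArc_of_lt [NullSingletonClass ν] {a b : ℝ} (ha : 0 ≤ a) (ha1 : a < 1)
    (hb : 1 < b) (hba : b ≤ a + 1) :
    ν.real (openArc a b) = 1 - circleCDF ν a + circleCDF ν (b - 1) := by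
  rw [← circleRep_preimage_of_lt ha ha1 hb hba, ← map_measureReal_apply measurable_circleRep
    (measurableSet_Ioc.union measurableSet_Ioo), measureReal_union ?_ measurableSet_Ioo,
    measureReal_congr Ioo_ae_eq_Ioc, real_Ioc_map_circleRep _ ha1.le,
    real_Ioc_map_circleRep _ (by linarith), circleCDF_zero, circleCDF_one, sub_zero]
  rw [Set.disjoint_left]
  intro x hx hx'
  linarith [hx.1, hx'.2]

theorem ext_of_circleCDF {ν₁ ν₂ : Measure UnitAddCircle} [IsProbabilityMeasure ν₁]
    [IsProbabilityMeasure ν₂] (h : ∀ t ∈ Icc (0 : ℝ) 1, circleCDF ν₁ t = circleCDF ν₂ t) :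
    ν₁ = ν₂ := by
  -- Representatives lie in `(0, 1]`, so every threshold may be clipped to `[0, 1]`.
  have hclip : ∀ t : ℝ, circleRep ⁻¹' Iic t = circleRep ⁻¹' Iic (max 0 (min t 1)) := by
    intro t
    ext x
    have := circleRep_mem x
    simp only [mem_preimage, mem_Iic, le_max_iff, le_min_iff]
    exact ⟨fun h => Or.inr ⟨h, this.2⟩, fun h => h.elim (fun h => absurd this.1 (not_lt.2 h)) And.left⟩
  have hmap : ν₁.map circleRep = ν₂.map circleRep := by
    refine Measure.ext_of_Iic _ _ fun t => ?_
    have h' := h (max 0 (min t 1)) ⟨le_max_left _ _, max_le zero_le_one (min_le_right _ _)⟩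
    rw [circleCDF, circleCDF, measureReal_eq_measureReal_iff] at h'
    simp only [Measure.map_apply measurable_circleRep measurableSet_Iic] at h' ⊢
    rw [hclip t, h']
  have hcoe : Measurable fun t : ℝ => (t : UnitAddCircle) :=
    UnitAddCircle.continuous_coe.measurable
  have hback : ∀ ν : Measure UnitAddCircle,
      (ν.map circleRep).map (fun t : ℝ => (t : UnitAddCircle)) = ν := fun ν => by
    rw [Measure.map_map hcoe measurable_circleRep,
      show (fun t : ℝ => (t : UnitAddCircle)) ∘ circleRep = id from funext coe_circleRep,
      Measure.map_id]
  rw [← hback ν₁, hmap, hback]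

/-- The difference of two nonatomic probability measures on the circle has a continuous
primitive. -/
theorem exists_primitive_sub (ν₁ ν₂ : Measure UnitAddCircle) [IsProbabilityMeasure ν₁]
    [IsProbabilityMeasure ν₂] [NullSingletonClass ν₁] [NullSingletonClass ν₂] :
    ∃ H : UnitAddCircle → ℝ, Continuous H ∧ (∀ a b : ℝ, a < b → b ≤ a + 1 →
      ν₁.real (openArc a b) - ν₂.real (openArc a b) = H b - H a) ∧
      ((∀ x y, H x = H y) → ν₁ = ν₂) := by
  set h : ℝ → ℝ := fun t => circleCDF ν₁ t - circleCDF ν₂ t with hh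
  have hc : Continuous h := (continuous_circleCDF ν₁).sub (continuous_circleCDF ν₂)
  have h0 : h 0 = 0 := by simp [hh, circleCDF_zero]
  have h1 : h 1 = 0 := by simp [hh, circleCDF_one]
  set H : UnitAddCircle → ℝ := AddCircle.liftIco 1 0 h with hH
  have hcoe : ∀ t ∈ Icc (0 : ℝ) 1, H t = h t := by
    intro t ht
    rcases ht.2.eq_or_lt with rfl | h2
    · have : ((1 : ℝ) : UnitAddCircle) = ((0 : ℝ) : UnitAddCircle) := by
        rw [AddCircle.coe_period, AddCircle.coe_zero]
      rw [this, hH, AddCircle.liftIco_zero_coe_apply ⟨le_rfl, one_pos⟩, h0, h1]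
    · rw [hH, AddCircle.liftIco_zero_coe_apply ⟨ht.1, h2⟩]
  -- Equal total masses give `h 0 = h 1`, which makes `H` continuous across the cut.
  refine ⟨H, AddCircle.liftIco_zero_continuous (h0.trans h1.symm) hc.continuousOn, ?_, ?_⟩
  · have key : ∀ a b : ℝ, 0 ≤ a → a < 1 → a < b → b ≤ a + 1 →
        ν₁.real (openArc a b) - ν₂.real (openArc a b) = H b - H a := by
      intro a b ha ha1 hab hb
      rw [hcoe a ⟨ha, ha1.le⟩]
      rcases le_or_gt b 1 with hb1 | hb1
      · rw [hcoe b ⟨ha.trans hab.le, hb1⟩, real_openArc_of_le _ ha hab.le hb1,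
          real_openArc_of_le _ ha hab.le hb1]
        simp only [hh]
        ring
      · have : (b : UnitAddCircle) = ((b - 1 : ℝ) : UnitAddCircle) := by
          rw [← AddCircle.coe_add_period 1 (b - 1), sub_add_cancel]
        rw [this, hcoe (b - 1) ⟨by linarith, by linarith⟩, real_openArc_of_lt _ ha ha1 hb1 hb,
          real_openArc_of_lt _ ha ha1 hb1 hb]
        simp only [hh]
        ring
    intro a b hab hb
    have hint : ∀ t : ℝ, ((t + (-⌊a⌋ : ℤ) : ℝ) : UnitAddCircle) = t := fun t => by
      rw [AddCircle.coe_add, show (((-⌊a⌋ : ℤ) : ℝ) : UnitAddCircle) = 0 from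
        (AddCircle.coe_eq_zero_iff 1).2 ⟨-⌊a⌋, by simp⟩, add_zero]
    have := key (a + (-⌊a⌋ : ℤ)) (b + (-⌊a⌋ : ℤ))
      (by push_cast; linarith [Int.floor_le a]) (by push_cast; linarith [Int.lt_floor_add_one a])
      (by linarith) (by linarith)
    rwa [openArc_add_intCast, hint, hint] at this
  · intro hconst
    refine ext_of_circleCDF fun t ht => ?_
    have := hconst t (0 : ℝ)
    rw [hcoe t ht, hcoe 0 ⟨le_rfl, zero_le_one⟩, h0] at this
    exact sub_eq_zero.1 this

end Primitive

/-! ### Finite invariant sets from two disjoint closed sets. -/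

section Components

/-- The boundary points of the components of the complement of `A` that meet `B`. -/
def separatingFrontier {X : Type*} [TopologicalSpace X] (A B : Set X) : Set X :=
  ⋃ y ∈ B, frontier (connectedComponentIn Aᶜ y)

/-- Components of the open set `Aᶜ` are open and pairwise disjoint or equal, so a finite subcover of
`B` already contains all that meet `B`. -/
theorem finite_components_meeting {X : Type*} [TopologicalSpace X] [LocallyConnectedSpace X]
    {A B : Set X} (hA : IsClosed A) (hB : IsCompact B) (hAB : Disjoint A B) :
    (connectedComponentIn Aᶜ '' B).Finite := by
  have hsub : ∀ y ∈ B, y ∈ connectedComponentIn Aᶜ y := fun y hy =>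
    mem_connectedComponentIn fun hyA => disjoint_left.1 hAB hyA hy
  obtain ⟨t, htB, htfin, hcov⟩ := hB.elim_finite_subcover_image
    (b := B) (c := fun y => connectedComponentIn Aᶜ y)
    (fun y _ => hA.isOpen_compl.connectedComponentIn)
    (fun y hy => mem_biUnion hy (hsub y hy))
  refine (htfin.image (connectedComponentIn Aᶜ)).subset ?_
  rintro _ ⟨y, hy, rfl⟩
  obtain ⟨z, hz, hyz⟩ := mem_iUnion₂.1 (hcov hy)
  exact ⟨z, hz, connectedComponentIn_eq hyz⟩

theorem image_mem_separatingFrontier {X : Type*} [TopologicalSpace X] (g : X ≃ₜ X)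
    {A B A' B' : Set X} (hAB : Disjoint A B) (hA : g '' A = A') (hB : g '' B = B') {x : X}
    (hx : x ∈ separatingFrontier A B) : g x ∈ separatingFrontier A' B' := by
  subst hA hB
  obtain ⟨y, hy, hxy⟩ := mem_iUnion₂.1 hx
  refine mem_iUnion₂.2 ⟨g y, mem_image_of_mem g hy, ?_⟩
  have hyA : y ∈ Aᶜ := fun hyA => disjoint_left.1 hAB hyA hy
  rw [← image_compl_eq g.bijective, ← g.image_connectedComponentIn hyA, ← g.image_frontier]
  exact mem_image_of_mem g hxy

instance : LocallyPathConnectedSpace UnitAddCircle :=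
  (QuotientAddGroup.isQuotientMap_mk
    (N := AddSubgroup.zmultiples (1 : ℝ))).locallyPathConnectedSpace

variable {A B : Set UnitAddCircle}

theorem exists_connectedComponentIn_eq_openArc (hA : IsClosed A) (hAB : Disjoint A B)
    (hne : A.Nonempty) {y : UnitAddCircle} (hy : y ∈ B) :
    ∃ a b : ℝ, a < b ∧ b ≤ a + 1 ∧ connectedComponentIn Aᶜ y = openArc a b := by
  refine exists_eq_openArc hA.isOpen_compl.connectedComponentIn isPreconnected_connectedComponentIn
    ⟨y, mem_connectedComponentIn fun hyA => disjoint_left.1 hAB hyA hy⟩ fun h => ?_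
  obtain ⟨x, hx⟩ := hne
  exact connectedComponentIn_subset _ _ (h.symm ▸ mem_univ x : x ∈ connectedComponentIn Aᶜ y) hx

theorem finite_separatingFrontier (hA : IsClosed A) (hB : IsClosed B) (hAB : Disjoint A B)
    (hne : A.Nonempty) : (separatingFrontier A B).Finite := by
  rw [separatingFrontier, ← biUnion_image (f := connectedComponentIn Aᶜ) (g := frontier)]
  refine (finite_components_meeting hA hB.isCompact hAB).biUnion ?_
  rintro _ ⟨y, hy, rfl⟩
  obtain ⟨a, b, hab, hb, h⟩ := exists_connectedComponentIn_eq_openArc hA hAB hne hy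
  rw [h, frontier_openArc hab hb]
  exact toFinite _

theorem nonempty_separatingFrontier (hA : IsClosed A) (hAB : Disjoint A B) (hneA : A.Nonempty)
    (hneB : B.Nonempty) : (separatingFrontier A B).Nonempty := by
  obtain ⟨y, hy⟩ := hneB
  obtain ⟨a, b, hab, hb, h⟩ := exists_connectedComponentIn_eq_openArc hA hAB hneA hy
  refine ⟨a, mem_iUnion₂.2 ⟨y, hy, ?_⟩⟩
  rw [h, frontier_openArc hab hb]
  exact Or.inl rfl

/-- The union of both separating frontiers is invariant even under elements that exchange `A` and
`B`. -/
theorem exists_preservesMeasure_of_disjoint {Γ : Subgroup (UnitAddCircle ≃ₜ UnitAddCircle)}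
    (hA : IsClosed A) (hB : IsClosed B) (hAB : Disjoint A B) (hneA : A.Nonempty)
    (hneB : B.Nonempty)
    (hinv : ∀ g ∈ Γ, (g '' A = A ∧ g '' B = B) ∨ (g '' A = B ∧ g '' B = A)) :
    ∃ ν : ProbabilityMeasure UnitAddCircle, PreservesMeasure Γ ν := by
  refine exists_preservesMeasure_of_finite
    (E := separatingFrontier A B ∪ separatingFrontier B A)
    ((finite_separatingFrontier hA hB hAB hneA).union
      (finite_separatingFrontier hB hA hAB.symm hneB))
    ((nonempty_separatingFrontier hA hAB hneA hneB).mono subset_union_left) fun g hg x hx => ?_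
  rcases hinv g hg with ⟨h1, h2⟩ | ⟨h1, h2⟩ <;> rcases hx with hx | hx
  · exact Or.inl (image_mem_separatingFrontier g hAB h1 h2 hx)
  · exact Or.inr (image_mem_separatingFrontier g hAB.symm h2 h1 hx)
  · exact Or.inr (image_mem_separatingFrontier g hAB h1 h2 hx)
  · exact Or.inl (image_mem_separatingFrontier g hAB.symm h2 h1 hx)

end Components

/-! ### Maximal arcs and uniqueness. -/

section Uniqueness

theorem exists_openArc_of_ne {x y : UnitAddCircle} (hxy : x ≠ y) :
    ∃ a b : ℝ, a < b ∧ b ≤ a + 1 ∧ (a : UnitAddCircle) = x ∧ (b : UnitAddCircle) = y := by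
  obtain ⟨a, rfl⟩ := QuotientAddGroup.mk_surjective x
  have hy : y ∈ (fun t : ℝ => (t : UnitAddCircle)) '' Ioc a (a + 1) := by
    rw [AddCircle.coe_image_Ioc_eq 1 a]
    exact mem_univ y
  obtain ⟨b, hb, rfl⟩ := hy
  exact ⟨a, b, hb.1, hb.2, rfl, rfl⟩

variable {Γ : Subgroup (UnitAddCircle ≃ₜ UnitAddCircle)}

/-- The image of one point of `A` decides the case for all pairs; the same applied to `g⁻¹` turns
inclusions into equalities. -/
theorem image_eq_or_swap {A B : Set UnitAddCircle} (hAB : Disjoint A B) (hneA : A.Nonempty)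
    (hneB : B.Nonempty)
    (h : ∀ g ∈ Γ, ∀ x ∈ A, ∀ y ∈ B, (g x ∈ A ∧ g y ∈ B) ∨ (g x ∈ B ∧ g y ∈ A)) :
    ∀ g ∈ Γ, (g '' A = A ∧ g '' B = B) ∨ (g '' A = B ∧ g '' B = A) := by
  have hd : ∀ z, z ∈ A → z ∈ B → False := fun z h1 h2 => disjoint_left.1 hAB h1 h2
  obtain ⟨a, ha⟩ := hneA
  obtain ⟨b, hb⟩ := hneB
  have hall : ∀ g ∈ Γ, (g a ∈ A → (∀ x ∈ A, g x ∈ A) ∧ ∀ y ∈ B, g y ∈ B) ∧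
      (g a ∈ B → (∀ x ∈ A, g x ∈ B) ∧ ∀ y ∈ B, g y ∈ A) := by
    intro g hg
    have h1 := h g hg
    constructor
    · intro hga
      have h2 : ∀ y ∈ B, g y ∈ B := fun y hy =>
        (h1 a ha y hy).elim And.right fun h3 => (hd _ hga h3.1).elim
      exact ⟨fun x hx => (h1 x hx b hb).elim And.left fun h3 => (hd _ h3.2 (h2 b hb)).elim, h2⟩
    · intro hga
      have h2 : ∀ y ∈ B, g y ∈ A := fun y hy =>
        (h1 a ha y hy).elim (fun h3 => (hd _ h3.1 hga).elim) And.right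
      exact ⟨fun x hx => (h1 x hx b hb).elim (fun h3 => (hd _ (h2 b hb) h3.2).elim) And.left, h2⟩
  intro g hg
  have hinv : ∀ z, g (g⁻¹ z) = z := fun z => g.apply_symm_apply z
  have hg' := Γ.inv_mem hg
  rcases h g hg a ha b hb with h1 | h1
  · obtain ⟨hA, hB⟩ := (hall g hg).1 h1.1
    have ha' : g⁻¹ a ∈ A := by
      rcases h _ hg' a ha b hb with h2 | h2
      · exact h2.1
      · exact (hd a ha (hinv a ▸ hB _ h2.1)).elim
    obtain ⟨hA', hB'⟩ := (hall _ hg').1 ha'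
    exact Or.inl ⟨Subset.antisymm (image_subset_iff.2 hA) fun z hz => ⟨_, hA' z hz, hinv z⟩,
      Subset.antisymm (image_subset_iff.2 hB) fun z hz => ⟨_, hB' z hz, hinv z⟩⟩
  · obtain ⟨hA, hB⟩ := (hall g hg).2 h1.1
    have ha' : g⁻¹ a ∈ B := by
      rcases h _ hg' a ha b hb with h2 | h2
      · exact (hd a ha (hinv a ▸ hA _ h2.1)).elim
      · exact h2.1
    obtain ⟨hA', hB'⟩ := (hall _ hg').2 ha'
    exact Or.inr ⟨Subset.antisymm (image_subset_iff.2 hA) fun z hz => ⟨_, hB' z hz, hinv z⟩,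
      Subset.antisymm (image_subset_iff.2 hB) fun z hz => ⟨_, hA' z hz, hinv z⟩⟩

/-- A primitive of the difference of two stationary measures maps the preimage of a pair of
extremal points to a pair of extremal points. -/
theorem maximal_arc_preimage {μ : PMF Γ} {ν₁ ν₂ : ProbabilityMeasure UnitAddCircle}
    {H : UnitAddCircle → ℝ} {x₀ x₁ : UnitAddCircle} (hmin : ∀ x, H x₀ ≤ H x)
    (hmax : ∀ x, H x ≤ H x₁)
    (hH : ∀ a b : ℝ, a < b → b ≤ a + 1 → (ν₁ : Measure UnitAddCircle).real (openArc a b)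
      - (ν₂ : Measure UnitAddCircle).real (openArc a b) = H b - H a)
    (h₁ : IsStationaryMeasure μ ν₁) (h₂ : IsStationaryMeasure μ ν₂) {x y : UnitAddCircle}
    (hx : H x = H x₀) (hy : H y = H x₁) (hxy : x ≠ y) {g : Γ} (hg : g ∈ μ.support) :
    (H ((g : UnitAddCircle ≃ₜ UnitAddCircle).symm x) = H x₀ ∧
      H ((g : UnitAddCircle ≃ₜ UnitAddCircle).symm y) = H x₁) ∨
    (H ((g : UnitAddCircle ≃ₜ UnitAddCircle).symm x) = H x₁ ∧
      H ((g : UnitAddCircle ≃ₜ UnitAddCircle).symm y) = H x₀) := by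
  obtain ⟨a, b, hab, hb, rfl, rfl⟩ := exists_openArc_of_ne hxy
  have hpre : ∀ g : Γ, ∃ a' b' : ℝ, a' < b' ∧ b' ≤ a' + 1 ∧
      (g : UnitAddCircle ≃ₜ UnitAddCircle) ⁻¹' openArc a b = openArc a' b' := fun g => by
    have hne : (openArc a b).Nonempty := (nonempty_Ioo.2 hab).image _
    refine exists_eq_openArc ((isOpen_openArc a b).preimage (Homeomorph.continuous _))
      ((Homeomorph.isPreconnected_preimage _).2 (isPreconnected_openArc a b))
      (hne.preimage (Homeomorph.surjective _)) fun h => ?_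
    obtain ⟨z, hz⟩ := (g : UnitAddCircle ≃ₜ UnitAddCircle).surjective (a : UnitAddCircle)
    have hz' : z ∈ (g : UnitAddCircle ≃ₜ UnitAddCircle) ⁻¹' openArc a b := h ▸ mem_univ z
    exact left_notMem_openArc hb (hz ▸ hz')
  set D : Set UnitAddCircle → ℝ := fun s =>
    (ν₁ : Measure UnitAddCircle).real s - (ν₂ : Measure UnitAddCircle).real s with hD
  have hreal : ∀ (ν : ProbabilityMeasure UnitAddCircle) (s : Set UnitAddCircle),
      |(ν : Measure UnitAddCircle).real s| ≤ 1 := fun ν s => by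
    rw [abs_of_nonneg measureReal_nonneg]
    exact measureReal_le_one
  have hsum : ∑' g : Γ, (μ g).toReal *
      D ((g : UnitAddCircle ≃ₜ UnitAddCircle) ⁻¹' openArc a b) = H x₁ - H x₀ := by
    rw [← hx, ← hy, ← hH a b hab hb, h₁.real_eq (isOpen_openArc a b).measurableSet,
      h₂.real_eq (isOpen_openArc a b).measurableSet,
      ← (μ.summable_toReal_mul fun g => hreal _ _).tsum_sub
        (μ.summable_toReal_mul fun g => hreal _ _)]
    simp only [hD, mul_sub]
  have hmaxg := μ.eq_of_tsum_toReal_mul_eq (C := 1 + 1)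
    (f := fun g : Γ => D ((g : UnitAddCircle ≃ₜ UnitAddCircle) ⁻¹' openArc a b))
    (fun g => (abs_sub _ _).trans (add_le_add (hreal _ _) (hreal _ _)))
    (fun g => by
      obtain ⟨a', b', hab', hb', h⟩ := hpre g
      rw [h, hD]
      linarith [hH a' b' hab' hb', hmax b', hmin a']) hsum hg
  obtain ⟨a', b', hab', hb', h⟩ := hpre g
  -- Comparing frontiers identifies endpoints only as unordered pairs, hence the swapped
  -- alternative, which orientation-reversing maps require.
  have hfr : ({(g : UnitAddCircle ≃ₜ UnitAddCircle).symm a,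
      (g : UnitAddCircle ≃ₜ UnitAddCircle).symm b} : Set UnitAddCircle)
      = {(a' : UnitAddCircle), (b' : UnitAddCircle)} := by
    rw [← frontier_openArc hab' hb', ← h, ← Homeomorph.preimage_frontier,
      frontier_openArc hab hb, ← Homeomorph.image_symm, image_pair]
  have hval : H b' - H a' = H x₁ - H x₀ := by
    rw [← hH a' b' hab' hb', ← h]
    exact hmaxg
  have ha' : H a' = H x₀ := by linarith [hmin a', hmax b']
  have hb'' : H b' = H x₁ := by linarith [hmin a', hmax b']
  rcases pair_eq_pair_iff.1 hfr with ⟨h1, h2⟩ | ⟨h1, h2⟩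
  · exact Or.inl ⟨h1 ▸ ha', h2 ▸ hb''⟩
  · exact Or.inr ⟨h1 ▸ hb'', h2 ▸ ha'⟩

theorem IsStationaryMeasure.unique {μ : PMF Γ} (hμ : IsNondegenerate μ)
    (hΓ : ¬ ∃ ν : ProbabilityMeasure UnitAddCircle, PreservesMeasure Γ ν)
    {ν₁ ν₂ : ProbabilityMeasure UnitAddCircle} (h₁ : IsStationaryMeasure μ ν₁)
    (h₂ : IsStationaryMeasure μ ν₂) : ν₁ = ν₂ := by
  have := h₁.nullSingletonClass hμ hΓ
  have := h₂.nullSingletonClass hμ hΓ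
  obtain ⟨H, hHc, hH, hext⟩ := exists_primitive_sub (ν₁ : Measure UnitAddCircle) ν₂
  refine Subtype.ext (hext ?_)
  by_contra hconst
  obtain ⟨x₀, -, hmin⟩ := isCompact_univ.exists_isMinOn univ_nonempty hHc.continuousOn
  obtain ⟨x₁, -, hmax⟩ := isCompact_univ.exists_isMaxOn univ_nonempty hHc.continuousOn
  replace hmin : ∀ x, H x₀ ≤ H x := fun x => hmin (mem_univ x)
  replace hmax : ∀ x, H x ≤ H x₁ := fun x => hmax (mem_univ x)
  have hne : H x₀ ≠ H x₁ := fun h => hconst fun x y => by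
    linarith [hmin x, hmax x, hmin y, hmax y]
  have hAB : Disjoint {x | H x = H x₀} {x | H x = H x₁} :=
    disjoint_left.2 fun x (h : H x = H x₀) (h' : H x = H x₁) => hne (h.symm.trans h')
  have hinv : ∀ g : Γ, ∀ x, H x = H x₀ → ∀ y, H y = H x₁ →
      (H ((g : UnitAddCircle ≃ₜ UnitAddCircle).symm x) = H x₀ ∧
        H ((g : UnitAddCircle ≃ₜ UnitAddCircle).symm y) = H x₁) ∨
      (H ((g : UnitAddCircle ≃ₜ UnitAddCircle).symm x) = H x₁ ∧
        H ((g : UnitAddCircle ≃ₜ UnitAddCircle).symm y) = H x₀) := by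
    refine hμ.induction (fun g hg x hx y hy => ?_) fun g h hg hh x hx y hy => ?_
    · exact maximal_arc_preimage hmin hmax hH h₁ h₂ hx hy
        (fun h => hne (hx.symm.trans ((congrArg H h).trans hy))) hg
    · rcases hg x hx y hy with h3 | h3
      · exact hh _ h3.1 _ h3.2
      · exact (hh _ h3.2 _ h3.1).symm.imp And.symm And.symm
  exact hΓ (exists_preservesMeasure_of_disjoint (isClosed_eq hHc continuous_const)
    (isClosed_eq hHc continuous_const) hAB ⟨x₀, rfl⟩ ⟨x₁, rfl⟩
    (image_eq_or_swap hAB ⟨x₀, rfl⟩ ⟨x₁, rfl⟩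
      -- `hinv` concerns inverses, so it is applied to `g⁻¹`.
      fun g hg x hx y hy => hinv ⟨g⁻¹, Γ.inv_mem hg⟩ x hx y hy))

end Uniqueness

/-! ### Existence by averaging the random walk. -/

section Existence

variable {Γ : Subgroup (UnitAddCircle ≃ₜ UnitAddCircle)}

instance isProbabilityMeasure_actionConvolution (μ : PMF Γ) (ν : Measure UnitAddCircle)
    [IsProbabilityMeasure ν] : IsProbabilityMeasure (actionConvolution μ ν) :=
  ⟨by simp [actionConvolution_apply μ ν MeasurableSet.univ, μ.tsum_coe]⟩

theorem integral_actionConvolution [Countable Γ] (μ : PMF Γ) (ν : Measure UnitAddCircle)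
    [IsProbabilityMeasure ν] (f : UnitAddCircle →ᵇ ℝ) :
    ∫ x, f x ∂(actionConvolution μ ν)
      = ∑' g : Γ, (μ g).toReal * ∫ x, f ((g : UnitAddCircle ≃ₜ UnitAddCircle) x) ∂ν := by
  have hint : Integrable f (actionConvolution μ ν) := f.integrable _
  rw [actionConvolution] at hint ⊢
  rw [integral_sum_measure hint]
  refine tsum_congr fun g => ?_
  rw [integral_smul_measure, integral_map (Homeomorph.continuous _).measurable.aemeasurable
    f.continuous.aestronglyMeasurable, smul_eq_mul]

theorem actionConvolution_smul (μ : PMF Γ) (c : ℝ≥0∞) (ν : Measure UnitAddCircle) :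
    actionConvolution μ (c • ν) = c • actionConvolution μ ν := by
  ext s hs
  simp only [Measure.smul_apply, actionConvolution_apply μ _ hs, smul_eq_mul,
    ← ENNReal.tsum_mul_left]
  exact tsum_congr fun g => by ring

theorem actionConvolution_finsetSum (μ : PMF Γ) {ι : Type*} (t : Finset ι)
    (ν : ι → Measure UnitAddCircle) :
    actionConvolution μ (∑ i ∈ t, ν i) = ∑ i ∈ t, actionConvolution μ (ν i) := by
  ext s hs
  simp only [Measure.finsetSum_apply, actionConvolution_apply μ _ hs, Finset.mul_sum]
  exact Summable.tsum_finsetSum fun i _ => ENNReal.summable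

/-- The law at time `n` of the random walk started at `0`. -/
noncomputable def walkLaw (μ : PMF Γ) (n : ℕ) : Measure UnitAddCircle :=
  (actionConvolution μ)^[n] (Measure.dirac 0)

instance (μ : PMF Γ) (n : ℕ) : IsProbabilityMeasure (walkLaw μ n) := by
  induction n with
  | zero => exact inferInstanceAs (IsProbabilityMeasure (Measure.dirac (0 : UnitAddCircle)))
  | succ n ih =>
    rw [walkLaw, Function.iterate_succ_apply']
    exact isProbabilityMeasure_actionConvolution μ (walkLaw μ n)

/-- The Cesàro means of the laws of the random walk started at `0`. -/
noncomputable def walkMean (μ : PMF Γ) (n : ℕ) : Measure UnitAddCircle :=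
  ((n + 1 : ℕ) : ℝ≥0∞)⁻¹ • ∑ k ∈ Finset.range (n + 1), walkLaw μ k

instance (μ : PMF Γ) (n : ℕ) : IsProbabilityMeasure (walkMean μ n) := by
  refine ⟨?_⟩
  rw [walkMean, Measure.smul_apply, Measure.finsetSum_apply]
  simp only [measure_univ, Finset.sum_const, Finset.card_range, nsmul_eq_mul, mul_one, smul_eq_mul]
  exact ENNReal.inv_mul_cancel (by simp) (ENNReal.natCast_ne_top _)

/-- Convolution shifts time by one, so the difference telescopes; the defect from stationarity is
`O(1/n)`. -/
theorem integral_actionConvolution_walkMean_sub (μ : PMF Γ) (n : ℕ) (f : UnitAddCircle →ᵇ ℝ) :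
    ∫ x, f x ∂(actionConvolution μ (walkMean μ n)) - ∫ x, f x ∂(walkMean μ n)
      = ((n + 1 : ℕ) : ℝ)⁻¹ * (∫ x, f x ∂(walkLaw μ (n + 1)) - ∫ x, f x ∂(walkLaw μ 0)) := by
  have hstep : ∀ k, actionConvolution μ (walkLaw μ k) = walkLaw μ (k + 1) := fun k => by
    rw [walkLaw, walkLaw, Function.iterate_succ_apply']
  have hint : ∀ k, Integrable f (walkLaw μ k) := fun k => f.integrable _
  rw [walkMean, actionConvolution_smul, actionConvolution_finsetSum, integral_smul_measure,
    integral_smul_measure, integral_finsetSum_measure (fun k _ => hint k)]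
  simp only [hstep]
  rw [integral_finsetSum_measure (fun k _ => hint (k + 1)), ← smul_sub, ← Finset.sum_sub_distrib,
    Finset.sum_range_sub (fun k => ∫ x, f x ∂(walkLaw μ k)), ENNReal.toReal_inv,
    ENNReal.toReal_natCast, smul_eq_mul]

theorem abs_integral_boundedContinuousFunction_le (ν : Measure UnitAddCircle)
    [IsProbabilityMeasure ν] (f : UnitAddCircle →ᵇ ℝ) : |∫ x, f x ∂ν| ≤ ‖f‖ := by
  simpa using f.norm_integral_le_norm ν

theorem exists_isStationaryMeasure [Countable Γ] (μ : PMF Γ) :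
    ∃ ν : ProbabilityMeasure UnitAddCircle, IsStationaryMeasure μ ν := by
  set m : ℕ → ProbabilityMeasure UnitAddCircle := fun n => ⟨walkMean μ n, inferInstance⟩ with hm
  set u : Ultrafilter ℕ := hyperfilter ℕ
  -- Probability measures on the circle form a compact space, so the means converge along an
  -- ultrafilter.
  obtain ⟨ν, -, hν⟩ := isCompact_univ.ultrafilter_le_nhds (u.map m) (by simp)
  have hlim : Tendsto m u (𝓝 ν) := hν
  have hlim' := ProbabilityMeasure.tendsto_iff_forall_integral_tendsto.1 hlim
  refine ⟨ν, ext_of_forall_integral_eq_of_IsFiniteMeasure fun f => ?_⟩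
  have h1 : Tendsto (fun n => ∫ x, f x ∂(actionConvolution μ (walkMean μ n))) u
      (𝓝 (∫ x, f x ∂(actionConvolution μ (ν : Measure UnitAddCircle)))) := by
    simp only [integral_actionConvolution]
    refine tendsto_tsum_of_dominated_convergence (bound := fun g => (μ g).toReal * ‖f‖)
      (μ.summable_toReal.mul_right _) (fun g => ?_) (Eventually.of_forall fun n g => ?_)
    · exact (hlim' (f.compContinuous
        ⟨(g : UnitAddCircle ≃ₜ UnitAddCircle), Homeomorph.continuous _⟩)).const_mul _
    · rw [norm_mul, Real.norm_of_nonneg ENNReal.toReal_nonneg]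
      refine mul_le_mul_of_nonneg_left ?_ ENNReal.toReal_nonneg
      set f' := f.compContinuous
        ⟨(g : UnitAddCircle ≃ₜ UnitAddCircle), Homeomorph.continuous _⟩ with hf'
      refine (abs_integral_boundedContinuousFunction_le (walkMean μ n) f').trans ?_
      exact (BoundedContinuousFunction.norm_le (norm_nonneg f)).2 fun x => f.norm_coe_le_norm _
  have h2 : Tendsto (fun n => ∫ x, f x ∂(walkMean μ n)) u
      (𝓝 (∫ x, f x ∂(ν : Measure UnitAddCircle))) := hlim' f
  have h3 : Tendsto (fun n => ∫ x, f x ∂(actionConvolution μ (walkMean μ n))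
      - ∫ x, f x ∂(walkMean μ n)) u (𝓝 0) := by
    have h4 : Tendsto (fun n : ℕ => ((n + 1 : ℕ) : ℝ)⁻¹ * (2 * ‖f‖)) atTop (𝓝 0) := by
      have := ((tendsto_natCast_atTop_atTop (R := ℝ)).comp (tendsto_add_atTop_nat 1)).inv_tendsto_atTop
      simpa using this.mul_const (2 * ‖f‖)
    refine squeeze_zero_norm (fun n => ?_)
      (h4.mono_left (Nat.hyperfilter_le_atTop))
    rw [integral_actionConvolution_walkMean_sub, norm_mul, Real.norm_of_nonneg (by positivity)]
    refine mul_le_mul_of_nonneg_left ?_ (by positivity)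
    refine (abs_sub _ _).trans ?_
    linarith [abs_integral_boundedContinuousFunction_le (walkLaw μ (n + 1)) f,
      abs_integral_boundedContinuousFunction_le (walkLaw μ 0) f]
  exact sub_eq_zero.1 (tendsto_nhds_unique (h1.sub h2) h3)

end Existence

theorem mainTheorem9 (Γ : Subgroup (UnitAddCircle ≃ₜ UnitAddCircle)) [Countable Γ] (μ : PMF Γ)
    (hμ : IsNondegenerate μ)
    (hΓ : ¬ ∃ ν : ProbabilityMeasure UnitAddCircle, PreservesMeasure Γ ν) :
    ∃! ν : ProbabilityMeasure UnitAddCircle, IsStationaryMeasure μ ν := by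
  obtain ⟨ν, hν⟩ := exists_isStationaryMeasure μ
  exact ⟨ν, hν, fun ν' hν' => hν'.unique hμ hΓ hν⟩
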